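/- Let $d_x,d_u\ge 1$ be the state and input dimensions, let $R_x\in\mathbb R^{d_x\times d_x}$ be symmetric with $R_x\succeq I$, and let $R_u=I\in\mathbb R^{d_u\times d_u}$. Here $\preceq$ is the Loewner order, $\|\cdot\|$ is the spectral norm, and a real square matrix is called stable if its spectral radius is less than $1$. A pair $(A,B)\in\mathbb R^{d_x\times d_x}\times\mathbb R^{d_x\times d_u}$ is stabilizable if $A+BK$ is stable for some $K\in\mathbb R^{d_u\times d_x}$. For stabilizable $(A,B)$, let $P_\infty(A,B)$ be the unique positive semidefinite solution of the discrete algebraic Riccati equation $$P=A^\top PA-A^\top PB(R_u+B^\top PB)^{-1}B^\top PA+R_x,$$ and let $K_\infty(A,B)=-(R_u+B^\top P_\infty(A,B)B)^{-1}B^\top P_\infty(A,B)A$. For stable $X$, let $\mathsf{dlyap}[X]$ be the unique positive semidefinite solution $P$ of $P-X^\top PX=I$, and let $\|X\|_{\mathcal H_\infty}=\sup_{z\in\mathbb C,\,|z|=1}\|(zI-X)^{-1}\|$. **Theorem.** Let $(A_\star,B_\star)$ be stabilizable, and put $P_\star=P_\infty(A_\star,B_\star)$, $K_\star=K_\infty(A_\star,B_\star)$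 and $A_{\mathrm{cl},\star}=A_\star+B_\star K_\star$. Let $(\widehat A,\widehat B)$ be a pair of matrices with $$\max\{\|\widehat A-A_\star\|,\|\widehat B-B_\star\|\}\le\frac1{54\,\|P_\star\|^5}.$$ Then $(\widehat A,\widehat B)$ is stabilizable, and, with $A_{\mathrm{cl},\widehat\star}=A_\star+B_\star K_\infty(\widehat A,\widehat B)$, the matrices $A_{\mathrm{cl},\star}$ and $A_{\mathrm{cl},\widehat\star}$ are stable. Moreover: 1. $I\preceq\mathsf{dlyap}[A_{\mathrm{cl},\star}]\preceq P_\star$. 2. $\|A_{\mathrm{cl},\widehat\star}\|_{\mathcal H_\infty}\le 2\|A_{\mathrm{cl},\star}\|_{\mathcal H_\infty}\le 4\,\|\mathsf{dlyap}[A_{\mathrm{cl},\star}]\|^{3/2}\le 4\,\|P_\star\|^{3/2}$. 3. $A_{\mathrm{cl},\widehat\star}^\top\,\mathsf{dlyap}[A_{\mathrm{cl},\star}]\,A_{\mathrm{cl},\widehat\star}\preceq\bigl(1-\tfrac12\|\mathsf{dlyap}[A_{\mathrm{cl},\star}]\|^{-1}\bigr)\mathsf{dlyap}[A_{\mathrm{cl},\star}]\preceq\bigl(1-\tfrac12\|P_\star\|^{-1}\bigr)\mathsf{dlyap}[A_{\mathrm{cl},\star}]$.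 -/

import Mathlib

open scoped Matrix Matrix.Norms.L2Operator MatrixOrder

noncomputable section

namespace LQR

/- Throughout, the norm of a matrix is the spectral norm (the operator norm between Euclidean
spaces), and `X ≤ Y` is the Loewner order: `Y - X` is symmetric positive semidefinite. -/

variable {n m : ℕ}

/-- The complexification of a real square matrix. -/
def toComplex (X : Matrix (Fin n) (Fin n) ℝ) : Matrix (Fin n) (Fin n) ℂ :=
  X.map ((↑) : ℝ → ℂ)

/-- A real matrix is stable if its spectral radius (the largest modulus of a complex eigenvalue)
is less than one. -/
def Stable (X : Matrix (Fin n) (Fin n) ℝ) : Prop :=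
  spectralRadius ℂ (toComplex X) < 1

/-- `(A, B)` is stabilizable if some static feedback `u = K x` makes the closed loop stable. -/
def Stabilizable (A : Matrix (Fin n) (Fin n) ℝ) (B : Matrix (Fin n) (Fin m) ℝ) : Prop :=
  ∃ K : Matrix (Fin m) (Fin n) ℝ, Stable (A + B * K)

/-- `P` is a positive semidefinite solution of the discrete algebraic Riccati equation. -/
def IsDARESolution (Rx : Matrix (Fin n) (Fin n) ℝ) (Ru : Matrix (Fin m) (Fin m) ℝ)
    (A : Matrix (Fin n) (Fin n) ℝ) (B : Matrix (Fin n) (Fin m) ℝ)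
    (P : Matrix (Fin n) (Fin n) ℝ) : Prop :=
  P.PosSemidef ∧
    P = Aᵀ * P * A - Aᵀ * P * B * (Ru + Bᵀ * P * B)⁻¹ * Bᵀ * P * A + Rx

open Classical in
/-- `P_∞(A, B)`: the positive semidefinite solution of the Riccati equation. It exists and is
unique if `(A, B)` is stabilizable and `Rx`, `Ru` are positive definite. -/
def Pinf (Rx : Matrix (Fin n) (Fin n) ℝ) (Ru : Matrix (Fin m) (Fin m) ℝ)
    (A : Matrix (Fin n) (Fin n) ℝ) (B : Matrix (Fin n) (Fin m) ℝ) :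
    Matrix (Fin n) (Fin n) ℝ :=
  if h : ∃ P, IsDARESolution Rx Ru A B P then h.choose else 0

/-- `K_∞(A, B)`: the optimal infinite-horizon controller. -/
def Kinf (Rx : Matrix (Fin n) (Fin n) ℝ) (Ru : Matrix (Fin m) (Fin m) ℝ)
    (A : Matrix (Fin n) (Fin n) ℝ) (B : Matrix (Fin n) (Fin m) ℝ) :
    Matrix (Fin m) (Fin n) ℝ :=
  -((Ru + Bᵀ * Pinf Rx Ru A B * B)⁻¹ * Bᵀ * Pinf Rx Ru A B * A)

open Classical in
/-- `dlyap(X, Y)` for `Y` positive semidefinite: the positive semidefinite solution `P` of the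
discrete Lyapunov equation `P - Xᵀ P X = Y`. It exists and is unique if `X` is stable. -/
def dlyap (X Y : Matrix (Fin n) (Fin n) ℝ) : Matrix (Fin n) (Fin n) ℝ :=
  if h : ∃ P : Matrix (Fin n) (Fin n) ℝ, P.PosSemidef ∧ P - Xᵀ * P * X = Y
  then h.choose else 0

/-- The `H_∞` norm of a stable matrix: the supremum of `‖(z I - X)⁻¹‖` over the complex unit
circle. -/
def HinfNorm (X : Matrix (Fin n) (Fin n) ℝ) : ℝ :=
  ⨆ z : Metric.sphere (0 : ℂ) 1,
    ‖((z : ℂ) • (1 : Matrix (Fin n) (Fin n) ℂ) - toComplex X)⁻¹‖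

/-- `C_safe(A, B) = 54 ‖P_∞(A, B)‖⁵`. -/
def Csafe (Rx : Matrix (Fin n) (Fin n) ℝ) (Ru : Matrix (Fin m) (Fin m) ℝ)
    (A : Matrix (Fin n) (Fin n) ℝ) (B : Matrix (Fin n) (Fin m) ℝ) : ℝ :=
  54 * ‖Pinf Rx Ru A B‖ ^ 5

end LQR

end

open scoped Matrix Matrix.Norms.L2Operator MatrixOrder

noncomputable section

namespace LQR

variable {n m : ℕ}

/-! Everything rests on matrix Lyapunov inequalities, scaled by s = √‖P‖. The Riccati map is a
minimum over feedbacks (`cost_eq_riccati_add`), so P equals the cost of its own gain K and is at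
most the one-step cost of any other gain. Since Rx ≥ 1, P is a Lyapunov function for A + BK, and K
and A + BK have norm at most s.

Running K on the perturbed pair changes the closed loop by at most 2sε, so P still decreases by (1 -
η) times the stage cost, with η of order s⁴ε (`IsDARESolution.perturbed_lyapunov`). This makes the
perturbed pair stabilizable. The comparison principle `nonneg_of_conj_le` then gives (1 - η)P' ≤ P.
Exchanging the two pairs gives the reverse bound, so ‖P - P'‖ ≤ 1/(10s⁴).

The gain difference Δ = K' - K enters the true closed loop only through BΔ. Pairing the linear
equation for Δ with Δ itself bounds ‖BΔ‖ with no factor ‖B‖ (`norm_mul_le_of_one_add_conj_mul_eq`),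
so ‖BΔ‖ ≤ 1/(5s³). This is small enough for D = dlyap to remain a Lyapunov function after the
perturbation.

Finally, the Lyapunov equation bounds the resolvent on the unit circle by 2‖D‖
(`norm_resolvent_le`), and the resolvent identity carries the estimate to the perturbed loop.
Uniqueness of Riccati or Lyapunov solutions is never used. -/

/-! ### Loewner order and spectral norm. -/

lemma le_iff_isSymm_and_quadratic {S T : Matrix (Fin n) (Fin n) ℝ} :
    S ≤ T ↔ (T - S).IsSymm ∧ ∀ v, v ⬝ᵥ (S *ᵥ v) ≤ v ⬝ᵥ (T *ᵥ v) := by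
  rw [Matrix.le_iff, Matrix.posSemidef_iff_dotProduct_mulVec]
  simp [Matrix.IsHermitian, Matrix.IsSymm, Matrix.sub_mulVec, dotProduct_sub]

lemma quadratic_mono {S T : Matrix (Fin n) (Fin n) ℝ} (h : S ≤ T) (v : Fin n → ℝ) :
    v ⬝ᵥ (S *ᵥ v) ≤ v ⬝ᵥ (T *ᵥ v) :=
  (le_iff_isSymm_and_quadratic.1 h).2 v

lemma isSymm_of_nonneg {S : Matrix (Fin n) (Fin n) ℝ} (h : 0 ≤ S) : S.IsSymm := by
  simpa using (le_iff_isSymm_and_quadratic.1 h).1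

lemma quadratic_conj (S : Matrix (Fin n) (Fin n) ℝ) (L : Matrix (Fin n) (Fin m) ℝ)
    (v : Fin m → ℝ) : v ⬝ᵥ ((Lᵀ * S * L) *ᵥ v) = (L *ᵥ v) ⬝ᵥ (S *ᵥ (L *ᵥ v)) := by
  rw [← Matrix.mulVec_mulVec, ← Matrix.mulVec_mulVec, Matrix.mulVec_transpose,
    dotProduct_comm, ← Matrix.dotProduct_mulVec, dotProduct_comm]

lemma quadratic_gram (L : Matrix (Fin n) (Fin m) ℝ) (v : Fin m → ℝ) :
    v ⬝ᵥ ((Lᵀ * L) *ᵥ v) = (L *ᵥ v) ⬝ᵥ (L *ᵥ v) := by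
  simpa using quadratic_conj 1 L v

lemma conj_mono {S T : Matrix (Fin n) (Fin n) ℝ} (h : S ≤ T) (L : Matrix (Fin n) (Fin m) ℝ) :
    Lᵀ * S * L ≤ Lᵀ * T * L := by
  have := Matrix.PosSemidef.conjTranspose_mul_mul_same h L
  rw [Matrix.le_iff]
  simpa [Matrix.mul_sub, Matrix.sub_mul] using this

lemma gram_nonneg (L : Matrix (Fin n) (Fin m) ℝ) : 0 ≤ Lᵀ * L := by
  simpa [Matrix.nonneg_iff_posSemidef] using Matrix.posSemidef_conjTranspose_mul_self L

lemma dotProduct_mulVec_self_le (S : Matrix (Fin n) (Fin m) ℝ) (v : Fin m → ℝ) :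
    (S *ᵥ v) ⬝ᵥ (S *ᵥ v) ≤ ‖S‖ ^ 2 * (v ⬝ᵥ v) := by
  have h2 := pow_le_pow_left₀ (norm_nonneg _) (S.l2_opNorm_mulVec (WithLp.toLp 2 v)) 2
  rw [mul_pow, EuclideanSpace.real_norm_sq_eq, EuclideanSpace.real_norm_sq_eq] at h2
  simpa [dotProduct, pow_two] using h2

lemma dotProduct_mulVec_le_norm (S : Matrix (Fin n) (Fin n) ℝ) (v : Fin n → ℝ) :
    v ⬝ᵥ (S *ᵥ v) ≤ ‖S‖ * (v ⬝ᵥ v) := by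
  have h := real_inner_le_norm (WithLp.toLp 2 v) (WithLp.toLp 2 (S *ᵥ v))
  have h1 := S.l2_opNorm_mulVec (WithLp.toLp 2 v)
  have h2 : v ⬝ᵥ v = ‖WithLp.toLp 2 v‖ ^ 2 := by
    rw [EuclideanSpace.real_norm_sq_eq]
    simp [dotProduct, pow_two]
  have h3 : inner ℝ (WithLp.toLp 2 v) (WithLp.toLp 2 (S *ᵥ v)) = v ⬝ᵥ (S *ᵥ v) := by
    simp [PiLp.inner_apply, dotProduct, mul_comm]
  rw [h3] at h
  rw [h2]
  have h4 : ‖WithLp.toLp 2 (S *ᵥ v)‖ ≤ ‖S‖ * ‖WithLp.toLp 2 v‖ := by simpa using h1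
  nlinarith [norm_nonneg (WithLp.toLp 2 v)]

lemma isSymm_le_norm_smul {S : Matrix (Fin n) (Fin n) ℝ} (hS : S.IsSymm) : S ≤ ‖S‖ • 1 := by
  rw [le_iff_isSymm_and_quadratic]
  refine ⟨?_, fun v => ?_⟩
  · simp [Matrix.IsSymm, hS.eq]
  · simpa [Matrix.smul_mulVec, dotProduct_smul] using dotProduct_mulVec_le_norm S v

lemma norm_le_of_gram_le {S : Matrix (Fin n) (Fin m) ℝ} {c : ℝ} (hc : 0 ≤ c)
    (h : Sᵀ * S ≤ c ^ 2 • 1) : ‖S‖ ≤ c := by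
  rw [Matrix.l2_opNorm_def]
  refine ContinuousLinearMap.opNorm_le_bound _ hc fun v => ?_
  have h1 := quadratic_mono h v.ofLp
  rw [quadratic_gram] at h1
  refine le_of_sq_le_sq ?_ (by positivity)
  rw [mul_pow, EuclideanSpace.real_norm_sq_eq, EuclideanSpace.real_norm_sq_eq]
  simpa [Matrix.smul_mulVec, dotProduct_smul, dotProduct, pow_two, Matrix.toLpLin_apply,
    Finset.mul_sum, mul_left_comm, mul_assoc] using h1

lemma gram_le_norm (S : Matrix (Fin n) (Fin m) ℝ) : Sᵀ * S ≤ ‖S‖ ^ 2 • 1 := by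
  have h := isSymm_le_norm_smul (isSymm_of_nonneg (gram_nonneg S))
  have h2 := S.l2_opNorm_conjTranspose_mul_self
  rw [Matrix.conjTranspose_eq_transpose_of_trivial] at h2
  rwa [h2, ← pow_two] at h

lemma norm_transpose (S : Matrix (Fin n) (Fin m) ℝ) : ‖Sᵀ‖ = ‖S‖ := by
  simpa using S.l2_opNorm_conjTranspose

lemma smul_one_mono {a b : ℝ} (h : a ≤ b) : a • (1 : Matrix (Fin n) (Fin n) ℝ) ≤ b • 1 := by
  rw [Matrix.le_iff, ← sub_smul]
  exact Matrix.PosSemidef.one.smul (sub_nonneg.2 h)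

lemma smul_mono {a b : ℝ} (h : a ≤ b) {S : Matrix (Fin n) (Fin n) ℝ} (hS : 0 ≤ S) :
    a • S ≤ b • S := by
  rw [Matrix.le_iff, ← sub_smul]
  exact (Matrix.nonneg_iff_posSemidef.1 hS).smul (sub_nonneg.2 h)

lemma smul_mono_right {a : ℝ} (h : 0 ≤ a) {S T : Matrix (Fin n) (Fin n) ℝ} (hS : S ≤ T) :
    a • S ≤ a • T := by
  rw [Matrix.le_iff, ← smul_sub]
  exact Matrix.PosSemidef.smul hS h

lemma norm_le_of_sandwich {T : Matrix (Fin n) (Fin n) ℝ} {c : ℝ} (hc : 0 < c)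
    (h1 : -(c • 1) ≤ T) (h2 : T ≤ c • 1) : ‖T‖ ≤ c := by
  have ha : 0 ≤ c • 1 - T := sub_nonneg.2 h2
  have hb : 0 ≤ c • 1 + T := by simpa [add_comm] using sub_nonneg.2 h1
  have hT : Tᵀ = T := by
    have := (isSymm_of_nonneg hb).eq
    simpa using this
  refine norm_le_of_gram_le hc.le ?_
  have e1 := conj_mono hb (c • 1 - T)
  have e2 := conj_mono ha (c • 1 + T)
  have e3 := smul_mono_right (a := (2 * c)⁻¹) (by positivity) (add_le_add e1 e2)
  rw [← sub_nonneg]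
  convert e3 using 1
  · simp
  · simp only [Matrix.transpose_sub, Matrix.transpose_add, Matrix.transpose_smul,
      Matrix.transpose_one, hT]
    -- The factors commute and the outer ones add up to 2c, so c² - T² is a positive multiple of a
    -- sum of two nonnegative conjugations; no spectral theorem is needed.
    have : (c • 1 - T) * (c • 1 + T) * (c • 1 - T) + (c • 1 + T) * (c • 1 - T) * (c • 1 + T)
        = (2 * c) • (c ^ 2 • 1 - T * T) := by
      simp only [mul_add, mul_sub, add_mul, sub_mul, smul_sub, smul_mul_assoc, mul_smul_comm,
        one_mul, mul_one, smul_smul, smul_add]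
      module
    rw [this, smul_smul, inv_mul_cancel₀ (by positivity), one_smul]

lemma norm_le_of_le_smul_one {S : Matrix (Fin n) (Fin n) ℝ} {c : ℝ} (hc : 0 < c) (hS : 0 ≤ S)
    (h : S ≤ c • 1) : ‖S‖ ≤ c := by
  refine norm_le_of_sandwich hc (le_trans ?_ hS) h
  have := smul_one_mono (n := n) hc.le
  rw [zero_smul] at this
  exact neg_nonpos.2 this

lemma norm_le_norm_of_le {S T : Matrix (Fin n) (Fin n) ℝ} (hS : 0 ≤ S) (h : S ≤ T) :
    ‖S‖ ≤ ‖T‖ := by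
  -- The slack e keeps the bound strictly positive, since ‖T‖ itself may vanish.
  refine le_of_forall_pos_le_add fun e he => norm_le_of_le_smul_one (by positivity) hS ?_
  refine h.trans ((isSymm_le_norm_smul (isSymm_of_nonneg (hS.trans h))).trans ?_)
  exact smul_one_mono (by linarith)

/-! ### Complexification. -/

lemma norm_sq_toComplex_mulVec (M : Matrix (Fin n) (Fin n) ℝ) (u : Fin n → ℂ) :
    ‖WithLp.toLp 2 (toComplex M *ᵥ u)‖ ^ 2 =
      (fun i => (u i).re) ⬝ᵥ ((Mᵀ * M) *ᵥ fun i => (u i).re) +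
      (fun i => (u i).im) ⬝ᵥ ((Mᵀ * M) *ᵥ fun i => (u i).im) := by
  rw [quadratic_gram, quadratic_gram, EuclideanSpace.norm_sq_eq]
  simp only [dotProduct, ← Finset.sum_add_distrib]
  refine Finset.sum_congr rfl fun i _ => ?_
  rw [← Complex.normSq_eq_norm_sq, Complex.normSq_apply]
  simp [Matrix.mulVec, dotProduct, toComplex]

lemma norm_sq_toLp_complex (u : Fin n → ℂ) :
    ‖WithLp.toLp 2 u‖ ^ 2 =
      (fun i => (u i).re) ⬝ᵥ (fun i => (u i).re) + (fun i => (u i).im) ⬝ᵥ fun i => (u i).im := by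
  have := norm_sq_toComplex_mulVec 1 u
  simpa [toComplex] using this

lemma toComplex_mul (X Y : Matrix (Fin n) (Fin n) ℝ) :
    toComplex (X * Y) = toComplex X * toComplex Y :=
  Matrix.map_mul (f := Complex.ofRealHom)

lemma toComplex_pow (X : Matrix (Fin n) (Fin n) ℝ) (k : ℕ) :
    toComplex (X ^ k) = toComplex X ^ k := by
  induction k with
  | zero => simp [toComplex]
  | succ k ih => rw [pow_succ, pow_succ, toComplex_mul, ih]

lemma norm_toComplex_le (X : Matrix (Fin n) (Fin n) ℝ) : ‖toComplex X‖ ≤ ‖X‖ := by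
  rw [Matrix.l2_opNorm_def]
  refine ContinuousLinearMap.opNorm_le_bound _ (norm_nonneg _) fun v => ?_
  refine le_of_sq_le_sq ?_ (by positivity)
  have h1 := norm_sq_toComplex_mulVec X v.ofLp
  have h2 := norm_sq_toLp_complex v.ofLp
  have h3 := dotProduct_mulVec_self_le X fun i => (v i).re
  have h4 := dotProduct_mulVec_self_le X fun i => (v i).im
  rw [quadratic_gram, quadratic_gram] at h1
  rw [mul_pow]
  simp only [Matrix.toLpLin_apply, LinearMap.coe_toContinuousLinearMap', WithLp.toLp_ofLp,
    LinearEquiv.trans_apply] at h1 h2 ⊢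
  rw [h1, h2]
  linarith

lemma norm_le_norm_toComplex (X : Matrix (Fin n) (Fin n) ℝ) : ‖X‖ ≤ ‖toComplex X‖ := by
  rw [Matrix.l2_opNorm_def X]
  refine ContinuousLinearMap.opNorm_le_bound _ (norm_nonneg _) fun v => ?_
  have h0 := (toComplex X).l2_opNorm_mulVec (WithLp.toLp 2 fun i => (v i : ℂ))
  refine le_of_sq_le_sq ?_ (by positivity)
  have h := pow_le_pow_left₀ (norm_nonneg _) h0 2
  have h1 := norm_sq_toComplex_mulVec X fun i => (v i : ℂ)
  have h2 := norm_sq_toLp_complex fun i => (v i : ℂ)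
  rw [quadratic_gram, quadratic_gram] at h1
  rw [mul_pow] at h ⊢
  rw [h2] at h
  have h' := h1.symm.le.trans h
  rw [EuclideanSpace.real_norm_sq_eq, EuclideanSpace.real_norm_sq_eq]
  have e : (X *ᵥ fun _ => (0 : ℝ)) = 0 := Matrix.mulVec_zero X
  simpa [dotProduct, pow_two, Matrix.toLpLin_apply, e] using h'

/-! ### Stability and Lyapunov inequalities. -/

lemma exists_gram {S : Matrix (Fin n) (Fin n) ℝ} (h : 0 ≤ S) :
    ∃ M : Matrix (Fin n) (Fin n) ℝ, S = Mᵀ * M := by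
  obtain ⟨M, hM⟩ := CStarAlgebra.nonneg_iff_eq_star_mul_self.1 h
  exact ⟨M, by simpa [Matrix.star_eq_conjTranspose] using hM⟩

lemma complex_lyapunov {M Y : Matrix (Fin n) (Fin n) ℝ} {c : ℝ}
    (h : Yᵀ * (Mᵀ * M) * Y + c • 1 ≤ Mᵀ * M) (u : Fin n → ℂ) :
    ‖WithLp.toLp 2 (toComplex M *ᵥ (toComplex Y *ᵥ u))‖ ^ 2 + c * ‖WithLp.toLp 2 u‖ ^ 2 ≤
      ‖WithLp.toLp 2 (toComplex M *ᵥ u)‖ ^ 2 := by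
  have h1 := norm_sq_toComplex_mulVec (M * Y) u
  rw [toComplex_mul, ← Matrix.mulVec_mulVec] at h1
  rw [h1, norm_sq_toComplex_mulVec M u, norm_sq_toLp_complex u]
  have h2 := quadratic_mono h fun i => (u i).re
  have h3 := quadratic_mono h fun i => (u i).im
  have e : (M * Y)ᵀ * (M * Y) = Yᵀ * (Mᵀ * M) * Y := by
    simp [Matrix.transpose_mul, Matrix.mul_assoc]
  rw [e]
  simp only [Matrix.add_mulVec, dotProduct_add, Matrix.smul_mulVec, Matrix.one_mulVec,
    dotProduct_smul, smul_eq_mul] at h2 h3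
  linarith

/-- On an eigenvector v with eigenvalue k and S = MᵀM, the hypothesis reads |k|²‖Mv‖² + c‖v‖² ≤
‖Mv‖², which forces |k| < 1. -/
lemma stable_of_lyapunov {S Y : Matrix (Fin n) (Fin n) ℝ} {c : ℝ} (hc : 0 < c) (hS : 0 ≤ S)
    (h : Yᵀ * S * Y + c • 1 ≤ S) : Stable Y := by
  rcases n.eq_zero_or_pos with rfl | hn
  · simp [Stable, spectrum.SpectralRadius.of_subsingleton]
  have : NeZero n := ⟨hn.ne'⟩
  obtain ⟨M, rfl⟩ := exists_gram hS
  refine spectrum.spectralRadius_lt_of_forall_lt (toComplex Y) (r := 1) fun k hk => ?_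
  rw [spectrum.mem_iff, Matrix.isUnit_iff_isUnit_det, isUnit_iff_ne_zero, not_not] at hk
  obtain ⟨v, hv, hv0⟩ := Matrix.exists_mulVec_eq_zero_iff.2 hk
  have hYv : toComplex Y *ᵥ v = k • v := by
    rw [Matrix.sub_mulVec, sub_eq_zero, Algebra.algebraMap_eq_smul_one, Matrix.smul_mulVec,
      Matrix.one_mulVec] at hv0
    exact hv0.symm
  have h1 := complex_lyapunov h v
  rw [hYv, Matrix.mulVec_smul, WithLp.toLp_smul, norm_smul, mul_pow] at h1
  have h2 : 0 < ‖WithLp.toLp 2 v‖ ^ 2 := by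
    have : WithLp.toLp 2 v ≠ 0 := by simpa using hv
    positivity
  rw [← NNReal.coe_lt_coe, coe_nnnorm, NNReal.coe_one]
  by_contra! hk1
  have h3 : 1 ≤ ‖k‖ ^ 2 := one_le_pow₀ hk1
  nlinarith [sq_nonneg ‖WithLp.toLp 2 (toComplex M *ᵥ v)‖, mul_pos hc h2]

/-- Gelfand's formula, applied to the complexification. -/
lemma exists_pow_norm_lt_one {Y : Matrix (Fin n) (Fin n) ℝ} (h : Stable Y) :
    ∃ N : ℕ, ‖Y ^ N‖ < 1 := by
  have h1 := spectrum.pow_nnnorm_pow_one_div_tendsto_nhds_spectralRadius (toComplex Y)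
  obtain ⟨N, hN, hN0⟩ := ((h1.eventually_lt_const h).and (Filter.eventually_gt_atTop 0)).exists
  refine ⟨N, (norm_le_norm_toComplex _).trans_lt ?_⟩
  rw [toComplex_pow]
  have : ((‖toComplex Y ^ N‖₊ : NNReal) : ENNReal) < 1 := by
    by_contra! hge
    exact absurd hN (not_lt.2 (ENNReal.one_le_rpow hge (by positivity)))
  exact_mod_cast this

lemma exists_lyapunov_of_stable {Y : Matrix (Fin n) (Fin n) ℝ} (h : Stable Y) :
    ∃ W : Matrix (Fin n) (Fin n) ℝ, 0 ≤ W ∧ Yᵀ * W * Y + 1 ≤ W := by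
  obtain ⟨N, hN⟩ := exists_pow_norm_lt_one h
  -- A truncated Lyapunov series avoids convergence: its defect (Y ^ N)ᵀ * Y ^ N is at most ‖Y ^ N‖²
  -- < 1, and rescaling absorbs it.
  let W0 : ℕ → Matrix (Fin n) (Fin n) ℝ := fun N => ∑ k ∈ Finset.range N, (Y ^ k)ᵀ * Y ^ k
  have hW0 : ∀ N, 0 ≤ W0 N := fun N => Finset.sum_nonneg fun k _ => gram_nonneg _
  have hrec : ∀ N, Yᵀ * W0 N * Y + 1 = W0 N + (Y ^ N)ᵀ * Y ^ N := by
    intro N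
    induction N with
    | zero => simp [W0]
    | succ N ih =>
      have e : W0 (N + 1) = W0 N + (Y ^ N)ᵀ * Y ^ N := Finset.sum_range_succ _ _
      rw [e, mul_add, add_mul, add_right_comm, ih, pow_succ, Matrix.transpose_mul]
      simp only [mul_assoc]
  have hr : 0 < 1 - ‖Y ^ N‖ ^ 2 := by nlinarith [norm_nonneg (Y ^ N)]
  refine ⟨(1 - ‖Y ^ N‖ ^ 2)⁻¹ • W0 N, ?_, ?_⟩
  · simpa using smul_mono_right (inv_nonneg.2 hr.le) (hW0 N)
  · have h1 : Yᵀ * W0 N * Y + (1 - ‖Y ^ N‖ ^ 2) • 1 ≤ W0 N := by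
      have := add_le_add_right (gram_le_norm (Y ^ N)) (W0 N)
      rw [← hrec] at this
      rw [sub_smul, one_smul, ← add_sub_assoc]
      exact sub_le_iff_le_add.2 this
    have h2 := smul_mono_right (inv_nonneg.2 hr.le) h1
    rwa [smul_add, smul_smul, inv_mul_cancel₀ hr.ne', one_smul, ← Matrix.smul_mul,
      ← Matrix.mul_smul] at h2

/-- Comparison principle. If vᵀTv < 0, the form T stays at or below that value along the orbit Yᵏv,
which keeps ‖Yᵏv‖ away from 0; but S decreases by at least c‖Yᵏv‖² at each step and is nonnegative.
-/
lemma nonneg_of_conj_le {S T Y : Matrix (Fin n) (Fin n) ℝ} {c : ℝ} (hc : 0 < c) (hS : 0 ≤ S)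
    (h : Yᵀ * S * Y + c • 1 ≤ S) (hT : T.IsSymm) (hTY : Yᵀ * T * Y ≤ T) : 0 ≤ T := by
  rw [le_iff_isSymm_and_quadratic]
  refine ⟨by simpa using hT, fun v => ?_⟩
  simp only [Matrix.zero_mulVec, dotProduct_zero]
  by_contra! hneg
  have hTk : ∀ k : ℕ, (Y ^ k *ᵥ v) ⬝ᵥ (T *ᵥ (Y ^ k *ᵥ v)) ≤ v ⬝ᵥ (T *ᵥ v) := by
    intro k
    induction k with
    | zero => simp
    | succ k ih =>
      refine le_trans ?_ ih
      have := quadratic_mono hTY (Y ^ k *ᵥ v)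
      rwa [quadratic_conj, Matrix.mulVec_mulVec, ← pow_succ'] at this
  have hlow : ∀ k : ℕ, -(v ⬝ᵥ (T *ᵥ v)) ≤ ‖T‖ * ((Y ^ k *ᵥ v) ⬝ᵥ (Y ^ k *ᵥ v)) := by
    intro k
    have := dotProduct_mulVec_le_norm (-T) (Y ^ k *ᵥ v)
    rw [Matrix.neg_mulVec, dotProduct_neg, norm_neg] at this
    linarith [hTk k]
  -- The decrease of S, multiplied by ‖T‖ so that `hlow` applies without division.
  have hsum : ∀ N : ℕ, c * (N * -(v ⬝ᵥ (T *ᵥ v))) +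
      ‖T‖ * ((Y ^ N *ᵥ v) ⬝ᵥ (S *ᵥ (Y ^ N *ᵥ v))) ≤ ‖T‖ * (v ⬝ᵥ (S *ᵥ v)) := by
    intro N
    induction N with
    | zero => simp
    | succ N ih =>
      have h1 := quadratic_mono h (Y ^ N *ᵥ v)
      rw [Matrix.add_mulVec, dotProduct_add, quadratic_conj, Matrix.mulVec_mulVec, ← pow_succ',
        Matrix.smul_mulVec, dotProduct_smul, Matrix.one_mulVec, smul_eq_mul] at h1
      have h2 := mul_le_mul_of_nonneg_left h1 (norm_nonneg T)
      have h3 := mul_le_mul_of_nonneg_left (hlow N) hc.le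
      push_cast
      linarith
  have hpos : 0 < c * -(v ⬝ᵥ (T *ᵥ v)) := mul_pos hc (by linarith)
  obtain ⟨N, hN⟩ := exists_nat_gt (‖T‖ * (v ⬝ᵥ (S *ᵥ v)) / (c * -(v ⬝ᵥ (T *ᵥ v))))
  rw [div_lt_iff₀ hpos] at hN
  have h4 := quadratic_mono hS (Y ^ N *ᵥ v)
  simp only [Matrix.zero_mulVec, dotProduct_zero] at h4
  have := hsum N
  nlinarith [mul_nonneg (norm_nonneg T) h4]

/-! ### The Riccati operator as a minimal cost. -/

/-- The Riccati operator with unit input cost. -/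
def riccati (Rx A : Matrix (Fin n) (Fin n) ℝ) (B : Matrix (Fin n) (Fin m) ℝ)
    (P : Matrix (Fin n) (Fin n) ℝ) : Matrix (Fin n) (Fin n) ℝ :=
  Aᵀ * P * A - Aᵀ * P * B * (1 + Bᵀ * P * B)⁻¹ * Bᵀ * P * A + Rx

/-- The minimizing feedback in the Riccati operator with unit input cost. -/
def riccatiGain (A : Matrix (Fin n) (Fin n) ℝ) (B : Matrix (Fin n) (Fin m) ℝ)
    (P : Matrix (Fin n) (Fin n) ℝ) : Matrix (Fin m) (Fin n) ℝ :=
  -((1 + Bᵀ * P * B)⁻¹ * Bᵀ * P * A)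

lemma conj_nonneg {S : Matrix (Fin n) (Fin n) ℝ} (h : 0 ≤ S) (L : Matrix (Fin n) (Fin m) ℝ) :
    0 ≤ Lᵀ * S * L := by
  simpa using conj_mono h L

lemma isUnit_one_add_conj {P : Matrix (Fin n) (Fin n) ℝ} (hP : 0 ≤ P)
    (B : Matrix (Fin n) (Fin m) ℝ) : IsUnit (1 + Bᵀ * P * B) :=
  (Matrix.PosDef.one.add_posSemidef (Matrix.nonneg_iff_posSemidef.1 (conj_nonneg hP B))).isUnit

lemma one_add_conj_mul_gain {P : Matrix (Fin n) (Fin n) ℝ} (hP : 0 ≤ P)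
    (A : Matrix (Fin n) (Fin n) ℝ) (B : Matrix (Fin n) (Fin m) ℝ) :
    (1 + Bᵀ * P * B) * riccatiGain A B P = -(Bᵀ * P * A) := by
  have := (Matrix.isUnit_iff_isUnit_det _).1 (isUnit_one_add_conj hP B)
  rw [riccatiGain, Matrix.mul_neg]
  simp only [Matrix.mul_assoc]
  rw [← Matrix.mul_assoc _ _ (Bᵀ * (P * A))]
  have e : (1 + Bᵀ * (P * B)) * (1 + Bᵀ * (P * B))⁻¹ = 1 := by
    rw [← Matrix.mul_assoc Bᵀ]
    exact Matrix.mul_nonsing_inv _ this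
  rw [e, Matrix.one_mul]

/-- Completing the square in the feedback L: the cost is quadratic in L with Hessian 1 + BᵀPB, and
`riccatiGain` is its critical point. -/
lemma cost_eq_riccati_add {P : Matrix (Fin n) (Fin n) ℝ} (hP : 0 ≤ P)
    (Rx A : Matrix (Fin n) (Fin n) ℝ) (B : Matrix (Fin n) (Fin m) ℝ)
    (L : Matrix (Fin m) (Fin n) ℝ) :
    (A + B * L)ᵀ * P * (A + B * L) + (Lᵀ * L + Rx) = riccati Rx A B P +
      (L - riccatiGain A B P)ᵀ * (1 + Bᵀ * P * B) * (L - riccatiGain A B P) := by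
  have hG := one_add_conj_mul_gain hP A B
  have hPs := (isSymm_of_nonneg hP).eq
  have hG' := congrArg Matrix.transpose hG
  have hGs : (1 + Bᵀ * P * B)ᵀ = 1 + Bᵀ * P * B := by
    simp [Matrix.transpose_mul, hPs, Matrix.mul_assoc]
  rw [Matrix.transpose_mul, hGs] at hG'
  simp only [Matrix.transpose_neg, Matrix.transpose_mul, Matrix.transpose_transpose, hPs] at hG'
  have e : riccati Rx A B P = Aᵀ * P * A + Aᵀ * P * B * riccatiGain A B P + Rx := by
    simp only [riccati, riccatiGain, Matrix.mul_neg, Matrix.mul_assoc, sub_eq_add_neg]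
  rw [e, Matrix.transpose_sub, Matrix.sub_mul, hG']
  rw [Matrix.mul_sub, Matrix.sub_mul, Matrix.sub_mul, Matrix.mul_assoc Lᵀ _ (riccatiGain A B P), hG]
  simp only [Matrix.transpose_add, Matrix.transpose_mul, Matrix.add_mul, Matrix.mul_add,
    Matrix.mul_assoc, Matrix.mul_one, Matrix.mul_neg,
    Matrix.neg_mul]
  abel

lemma riccati_le_cost {P : Matrix (Fin n) (Fin n) ℝ} (hP : 0 ≤ P)
    (Rx A : Matrix (Fin n) (Fin n) ℝ) (B : Matrix (Fin n) (Fin m) ℝ)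
    (L : Matrix (Fin m) (Fin n) ℝ) :
    riccati Rx A B P ≤ (A + B * L)ᵀ * P * (A + B * L) + (Lᵀ * L + Rx) := by
  rw [cost_eq_riccati_add hP]
  refine le_add_of_nonneg_right (conj_nonneg ?_ _)
  exact add_nonneg (Matrix.nonneg_iff_posSemidef.2 Matrix.PosSemidef.one) (conj_nonneg hP B)

lemma riccati_eq_cost {P : Matrix (Fin n) (Fin n) ℝ} (hP : 0 ≤ P)
    (Rx A : Matrix (Fin n) (Fin n) ℝ) (B : Matrix (Fin n) (Fin m) ℝ) :
    riccati Rx A B P = (A + B * riccatiGain A B P)ᵀ * P * (A + B * riccatiGain A B P) +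
      ((riccatiGain A B P)ᵀ * riccatiGain A B P + Rx) := by
  rw [cost_eq_riccati_add hP]
  simp

lemma riccati_mono {P P' : Matrix (Fin n) (Fin n) ℝ} (hP : 0 ≤ P) (h : P ≤ P')
    (Rx A : Matrix (Fin n) (Fin n) ℝ) (B : Matrix (Fin n) (Fin m) ℝ) :
    riccati Rx A B P ≤ riccati Rx A B P' := by
  rw [riccati_eq_cost (hP.trans h)]
  exact (riccati_le_cost hP Rx A B _).trans (add_le_add_left (conj_mono h _) _)

lemma riccati_nonneg {P : Matrix (Fin n) (Fin n) ℝ} (hP : 0 ≤ P)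
    {Rx : Matrix (Fin n) (Fin n) ℝ} (hRx : 0 ≤ Rx) (A : Matrix (Fin n) (Fin n) ℝ)
    (B : Matrix (Fin n) (Fin m) ℝ) : 0 ≤ riccati Rx A B P := by
  rw [riccati_eq_cost hP]
  exact add_nonneg (conj_nonneg hP _) (add_nonneg (gram_nonneg _) hRx)

/-! ### Existence of Riccati and Lyapunov solutions. -/

lemma exists_tendsto_of_monotone {P : ℕ → Matrix (Fin n) (Fin n) ℝ}
    {W : Matrix (Fin n) (Fin n) ℝ} (h0 : ∀ k, 0 ≤ P k) (hmono : Monotone P)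
    (hW : ∀ k, P k ≤ W) :
    ∃ Q, 0 ≤ Q ∧ Filter.Tendsto P Filter.atTop (nhds Q) := by
  have hq : ∀ v : Fin n → ℝ, ∃ l, Filter.Tendsto (fun k => v ⬝ᵥ (P k *ᵥ v))
      Filter.atTop (nhds l) := fun v =>
    ⟨_, tendsto_atTop_ciSup (fun i j hij => quadratic_mono (hmono hij) v)
      ⟨v ⬝ᵥ (W *ᵥ v), by rintro _ ⟨k, rfl⟩; exact quadratic_mono (hW k) v⟩⟩
  choose l hl using hq
  -- Polarization recovers the entries from the quadratic forms, which converge because they are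
  -- monotone and bounded.
  have hpol : ∀ k i j, P k i j = 4⁻¹ * ((Pi.single i 1 + Pi.single j 1) ⬝ᵥ
      (P k *ᵥ (Pi.single i 1 + Pi.single j 1)) - (Pi.single i 1 - Pi.single j 1) ⬝ᵥ
      (P k *ᵥ (Pi.single i 1 - Pi.single j 1))) := by
    intro k i j
    have := (isSymm_of_nonneg (h0 k)).apply i j
    simp only [Matrix.mulVec_add, Matrix.mulVec_sub, add_dotProduct, sub_dotProduct,
      dotProduct_add, dotProduct_sub, Matrix.mulVec_single_one, single_one_dotProduct,
      Matrix.col_apply, this]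
    ring
  have ht : Filter.Tendsto P Filter.atTop (nhds (Matrix.of fun i j =>
      4⁻¹ * (l (Pi.single i 1 + Pi.single j 1) - l (Pi.single i 1 - Pi.single j 1)))) := by
    refine tendsto_pi_nhds.2 fun i => tendsto_pi_nhds.2 fun j => ?_
    simp only [hpol _ i j]
    exact ((hl _).sub (hl _)).const_mul _
  refine ⟨_, ?_, ht⟩
  rw [le_iff_isSymm_and_quadratic]
  refine ⟨?_, fun v => ?_⟩
  · rw [sub_zero]
    refine tendsto_nhds_unique (((continuous_id.matrix_transpose).tendsto _).comp ht) ?_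
    exact ht.congr fun k => (isSymm_of_nonneg (h0 k)).eq.symm
  · rw [Matrix.zero_mulVec, dotProduct_zero]
    have hc : Continuous fun S : Matrix (Fin n) (Fin n) ℝ => v ⬝ᵥ (S *ᵥ v) := by fun_prop
    refine ge_of_tendsto' ((hc.tendsto _).comp ht) fun k => ?_
    simpa using quadratic_mono (h0 k) v

lemma continuousAt_riccati {P : Matrix (Fin n) (Fin n) ℝ} (hP : 0 ≤ P)
    (Rx A : Matrix (Fin n) (Fin n) ℝ) (B : Matrix (Fin n) (Fin m) ℝ) :
    ContinuousAt (riccati Rx A B) P := by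
  have h1 : ContinuousAt (fun S : Matrix (Fin n) (Fin n) ℝ => (1 + Bᵀ * S * B)⁻¹) P := by
    simp only [Matrix.nonsing_inv_eq_ringInverse]
    have hc : Continuous fun S : Matrix (Fin n) (Fin n) ℝ => 1 + Bᵀ * S * B := by fun_prop
    obtain ⟨u, hu⟩ := isUnit_one_add_conj hP B
    have := NormedRing.inverse_continuousAt u
    rw [hu] at this
    exact ContinuousAt.comp (f := fun S : Matrix (Fin n) (Fin n) ℝ => 1 + Bᵀ * S * B) this
      hc.continuousAt
  unfold riccati
  refine ContinuousAt.add (ContinuousAt.sub ?_ ?_) continuousAt_const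
  · exact Continuous.continuousAt (by fun_prop)
  · have hc : ∀ {a b c : ℕ} {f : Matrix (Fin n) (Fin n) ℝ → Matrix (Fin a) (Fin b) ℝ}
        {g : Matrix (Fin n) (Fin n) ℝ → Matrix (Fin b) (Fin c) ℝ}, ContinuousAt f P →
        ContinuousAt g P → ContinuousAt (fun S => f S * g S) P := fun hf hg =>
      (Continuous.matrix_mul continuous_fst continuous_snd).continuousAt.comp (hf.prodMk hg)
    refine hc (hc (hc (hc (hc (hc continuousAt_const continuousAt_id) continuousAt_const) h1)
      continuousAt_const) continuousAt_id) continuousAt_const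

/-- Value iteration from 0 is monotone. A multiple of a Lyapunov matrix for a stabilizing K
dominates the cost of K, hence every iterate; the limit is a fixed point by continuity. -/
lemma exists_isDARESolution {Rx : Matrix (Fin n) (Fin n) ℝ} (hRx : 0 ≤ Rx)
    {A : Matrix (Fin n) (Fin n) ℝ} {B : Matrix (Fin n) (Fin m) ℝ} (h : Stabilizable A B) :
    ∃ P, IsDARESolution Rx 1 A B P := by
  obtain ⟨K, hK⟩ := h
  obtain ⟨W₁, hW₁, hW₁'⟩ := exists_lyapunov_of_stable hK
  have hQ : 0 ≤ Kᵀ * K + Rx := add_nonneg (gram_nonneg K) hRx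
  have hW : 0 ≤ ‖Kᵀ * K + Rx‖ • W₁ := by simpa using smul_mono_right (norm_nonneg _) hW₁
  have hWY : (A + B * K)ᵀ * (‖Kᵀ * K + Rx‖ • W₁) * (A + B * K) + (Kᵀ * K + Rx) ≤
      ‖Kᵀ * K + Rx‖ • W₁ := by
    refine le_trans ?_ (smul_mono_right (norm_nonneg (Kᵀ * K + Rx)) hW₁')
    rw [smul_add, Matrix.mul_smul, Matrix.smul_mul]
    exact add_le_add_right (isSymm_le_norm_smul (isSymm_of_nonneg hQ)) _
  let P : ℕ → Matrix (Fin n) (Fin n) ℝ := fun k => (riccati Rx A B)^[k] 0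
  have hs : ∀ k, P (k + 1) = riccati Rx A B (P k) := fun k => Function.iterate_succ_apply' _ _ _
  have h0 : ∀ k, 0 ≤ P k := by
    intro k
    induction k with
    | zero => exact le_rfl
    | succ k ih => rw [hs]; exact riccati_nonneg ih hRx A B
  have hmono : Monotone P := by
    refine monotone_nat_of_le_succ fun k => ?_
    induction k with
    | zero => exact h0 1
    | succ k ih => rw [hs k, hs (k + 1)]; exact riccati_mono (h0 k) ih Rx A B
  have hb : ∀ k, P k ≤ ‖Kᵀ * K + Rx‖ • W₁ := by
    intro k
    induction k with
    | zero => exact hW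
    | succ k ih =>
      rw [hs]
      exact (riccati_le_cost (h0 k) Rx A B K).trans
        ((add_le_add_left (conj_mono ih _) _).trans hWY)
  obtain ⟨Q, hQ0, hQt⟩ := exists_tendsto_of_monotone h0 hmono hb
  refine ⟨Q, Matrix.nonneg_iff_posSemidef.1 hQ0, ?_⟩
  have h1 := (continuousAt_riccati hQ0 Rx A B).tendsto.comp hQt
  have h2 := hQt.comp (Filter.tendsto_add_atTop_nat 1)
  exact tendsto_nhds_unique h2 (h1.congr fun k => (hs k).symm)

lemma isDARESolution_Pinf {Rx : Matrix (Fin n) (Fin n) ℝ} (hRx : 0 ≤ Rx)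
    {A : Matrix (Fin n) (Fin n) ℝ} {B : Matrix (Fin n) (Fin m) ℝ} (h : Stabilizable A B) :
    IsDARESolution Rx 1 A B (Pinf Rx 1 A B) := by
  have := exists_isDARESolution hRx h
  rw [Pinf, dif_pos this]
  exact this.choose_spec

lemma exists_dlyap {X : Matrix (Fin n) (Fin n) ℝ} (h : Stable X) :
    0 ≤ dlyap X 1 ∧ dlyap X 1 = Xᵀ * dlyap X 1 * X + 1 := by
  have : ∃ P : Matrix (Fin n) (Fin n) ℝ, P.PosSemidef ∧ P - Xᵀ * P * X = 1 := by
    -- With no inputs the Riccati equation is the Lyapunov equation.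
    obtain ⟨P, hP, hP'⟩ := exists_isDARESolution (Rx := 1) (A := X)
      (B := (0 : Matrix (Fin n) (Fin 0) ℝ))
      (Matrix.nonneg_iff_posSemidef.2 Matrix.PosSemidef.one) ⟨0, by simpa using h⟩
    refine ⟨P, hP, ?_⟩
    simp only [Matrix.mul_zero, Matrix.zero_mul, sub_zero] at hP'
    rw [sub_eq_iff_eq_add, add_comm]
    exact hP'
  rw [dlyap, dif_pos this]
  refine ⟨Matrix.nonneg_iff_posSemidef.2 this.choose_spec.1, ?_⟩
  rw [add_comm, ← sub_eq_iff_eq_add]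
  exact this.choose_spec.2

/-! ### Perturbation of Riccati solutions and gains. -/

lemma conj_add_le {P : Matrix (Fin n) (Fin n) ℝ} (hP : P.IsSymm)
    (X E : Matrix (Fin n) (Fin n) ℝ) :
    (X + E)ᵀ * P * (X + E) ≤ Xᵀ * P * X + (2 * ‖P‖ * ‖X‖ * ‖E‖ + ‖P‖ * ‖E‖ ^ 2) • 1 := by
  let H := Eᵀ * (P * X) + (Eᵀ * (P * X))ᵀ + Eᵀ * (P * E)
  have hH : H.IsSymm := by
    simp only [H, Matrix.IsSymm, Matrix.transpose_add, Matrix.transpose_mul,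
      Matrix.transpose_transpose, hP.eq, Matrix.mul_assoc]
    abel
  have e : (X + E)ᵀ * P * (X + E) = Xᵀ * P * X + H := by
    simp only [H, Matrix.transpose_add, Matrix.transpose_mul, Matrix.add_mul, Matrix.mul_add,
      Matrix.transpose_transpose, hP.eq, Matrix.mul_assoc]
    abel
  rw [e]
  have h1 : ∀ Z : Matrix (Fin n) (Fin n) ℝ, ‖Eᵀ * (P * Z)‖ ≤ ‖E‖ * (‖P‖ * ‖Z‖) := fun Z => by
    refine (Matrix.l2_opNorm_mul _ _).trans ?_
    rw [norm_transpose]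
    exact mul_le_mul_of_nonneg_left (Matrix.l2_opNorm_mul _ _) (norm_nonneg _)
  have h2 : ‖H‖ ≤ 2 * ‖P‖ * ‖X‖ * ‖E‖ + ‖P‖ * ‖E‖ ^ 2 := by
    refine (norm_add₃_le).trans ?_
    rw [norm_transpose]
    linarith [h1 X, h1 E]
  exact add_le_add_right ((isSymm_le_norm_smul hH).trans (smul_one_mono h2)) _

section DARE

variable {Rx A : Matrix (Fin n) (Fin n) ℝ} {B : Matrix (Fin n) (Fin m) ℝ}
  {P : Matrix (Fin n) (Fin n) ℝ}

lemma IsDARESolution.nonneg (h : IsDARESolution Rx 1 A B P) : 0 ≤ P :=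
  Matrix.nonneg_iff_posSemidef.2 h.1

lemma IsDARESolution.eq_cost (h : IsDARESolution Rx 1 A B P) :
    P = (A + B * riccatiGain A B P)ᵀ * P * (A + B * riccatiGain A B P) +
      ((riccatiGain A B P)ᵀ * riccatiGain A B P + Rx) := by
  have := riccati_eq_cost h.nonneg Rx A B
  rw [← this]
  exact h.2

lemma IsDARESolution.le_cost (h : IsDARESolution Rx 1 A B P) (L : Matrix (Fin m) (Fin n) ℝ) :
    P ≤ (A + B * L)ᵀ * P * (A + B * L) + (Lᵀ * L + Rx) := by
  have := riccati_le_cost h.nonneg Rx A B L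
  exact h.2.le.trans this

lemma zero_le_one_matrix : (0 : Matrix (Fin n) (Fin n) ℝ) ≤ 1 :=
  Matrix.nonneg_iff_posSemidef.2 Matrix.PosSemidef.one

lemma one_le_gram_add (hRx : 1 ≤ Rx) (K : Matrix (Fin m) (Fin n) ℝ) : 1 ≤ Kᵀ * K + Rx :=
  hRx.trans (le_add_of_nonneg_left (gram_nonneg K))

lemma IsDARESolution.lyapunov (h : IsDARESolution Rx 1 A B P) (hRx : 1 ≤ Rx) :
    (A + B * riccatiGain A B P)ᵀ * P * (A + B * riccatiGain A B P) + 1 ≤ P := by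
  conv_rhs => rw [h.eq_cost]
  exact add_le_add_right (one_le_gram_add hRx _) _

lemma IsDARESolution.one_le (h : IsDARESolution Rx 1 A B P) (hRx : 1 ≤ Rx) : 1 ≤ P :=
  (le_add_of_nonneg_left (conj_nonneg h.nonneg _)).trans (h.lyapunov hRx)

lemma IsDARESolution.stable (h : IsDARESolution Rx 1 A B P) (hRx : 1 ≤ Rx) :
    Stable (A + B * riccatiGain A B P) :=
  stable_of_lyapunov one_pos h.nonneg (by simpa using h.lyapunov hRx)

lemma le_smul_one_of_norm_le {c : ℝ} (h0 : 0 ≤ P) (h : ‖P‖ ≤ c) : P ≤ c • 1 :=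
  (isSymm_le_norm_smul (isSymm_of_nonneg h0)).trans (smul_one_mono h)

lemma IsDARESolution.norm_gain_le (h : IsDARESolution Rx 1 A B P) (hRx : 1 ≤ Rx) {s : ℝ}
    (hs : 0 ≤ s) (hP : ‖P‖ ≤ s ^ 2) : ‖riccatiGain A B P‖ ≤ s := by
  refine norm_le_of_gram_le hs (le_trans ?_ (le_smul_one_of_norm_le h.nonneg hP))
  conv_rhs => rw [h.eq_cost]
  exact (le_add_of_nonneg_right (zero_le_one_matrix.trans hRx)).trans
    (le_add_of_nonneg_left (conj_nonneg h.nonneg _))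

lemma norm_le_of_lyapunov {X : Matrix (Fin n) (Fin n) ℝ} (h1 : 1 ≤ P) (h : Xᵀ * P * X + 1 ≤ P)
    {s : ℝ} (hs : 0 ≤ s) (hP : ‖P‖ ≤ s ^ 2) : ‖X‖ ≤ s := by
  refine norm_le_of_gram_le hs (le_trans ?_
    (le_smul_one_of_norm_le (zero_le_one_matrix.trans h1) hP))
  refine le_trans ?_ ((le_add_of_nonneg_right zero_le_one_matrix).trans h)
  simpa using conj_mono h1 X

variable {A' : Matrix (Fin n) (Fin n) ℝ} {B' : Matrix (Fin n) (Fin m) ℝ} {s ε η : ℝ}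

lemma norm_closedLoop_sub_le {K : Matrix (Fin m) (Fin n) ℝ} (hs : 1 ≤ s) (hε : 0 ≤ ε)
    (hK : ‖K‖ ≤ s) (hA : ‖A' - A‖ ≤ ε) (hB : ‖B' - B‖ ≤ ε) :
    ‖(A' - A) + (B' - B) * K‖ ≤ 2 * s * ε := by
  have h1 := (Matrix.l2_opNorm_mul (B' - B) K).trans
    (mul_le_mul hB hK (norm_nonneg _) hε)
  have h2 := norm_add_le (A' - A) ((B' - B) * K)
  nlinarith

/-- The nominal gain K is kept on the perturbed pair. The error is charged to the full stage cost,
not just to the identity, so that comparison with the other Riccati solution is multiplicative. -/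
lemma IsDARESolution.perturbed_lyapunov (h : IsDARESolution Rx 1 A B P) (hRx : 1 ≤ Rx)
    (hs : 1 ≤ s) (hP : ‖P‖ ≤ s ^ 2) (hε : 0 ≤ ε) (hA : ‖A' - A‖ ≤ ε) (hB : ‖B' - B‖ ≤ ε)
    (hη : 4 * s ^ 4 * ε * (1 + ε) ≤ η) :
    (A' + B' * riccatiGain A B P)ᵀ * P * (A' + B' * riccatiGain A B P) +
      (1 - η) • ((riccatiGain A B P)ᵀ * riccatiGain A B P + Rx) ≤ P := by
  set K := riccatiGain A B P with hKdef
  have hs0 : 0 ≤ s := by linarith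
  have hK : ‖K‖ ≤ s := h.norm_gain_le hRx hs0 hP
  have hX : ‖A + B * K‖ ≤ s := norm_le_of_lyapunov (h.one_le hRx) (h.lyapunov hRx) hs0 hP
  have hE := norm_closedLoop_sub_le hs hε hK hA hB
  have e : A' + B' * K = (A + B * K) + ((A' - A) + (B' - B) * K) := by
    rw [Matrix.sub_mul]; abel
  have h0η : 0 ≤ η := le_trans (by positivity) hη
  have h1 := conj_add_le (isSymm_of_nonneg h.nonneg) (A + B * K) ((A' - A) + (B' - B) * K)
  rw [← e] at h1
  have h2 : 2 * ‖P‖ * ‖A + B * K‖ * ‖(A' - A) + (B' - B) * K‖ +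
      ‖P‖ * ‖(A' - A) + (B' - B) * K‖ ^ 2 ≤ η := by
    -- Uses ‖P‖ ≤ s², ‖A + BK‖ ≤ s and a closed-loop error of at most 2sε.
    calc _ ≤ 2 * s ^ 2 * s * (2 * s * ε) + s ^ 2 * (2 * s * ε) ^ 2 := by gcongr
      _ = 4 * s ^ 4 * ε * (1 + ε) := by ring
      _ ≤ η := hη
  have h3 : η • (1 : Matrix (Fin n) (Fin n) ℝ) ≤ η • (Kᵀ * K + Rx) :=
    smul_mono_right h0η (one_le_gram_add hRx K)
  have h4 := h1.trans (add_le_add_right ((smul_one_mono h2).trans h3) _)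
  have h5 := h.eq_cost
  rw [← hKdef] at h5
  refine (add_le_add_left h4 _).trans (le_of_eq ?_)
  conv_rhs => rw [h5]
  module

lemma IsDARESolution.perturbed_stabilizable (h : IsDARESolution Rx 1 A B P) (hRx : 1 ≤ Rx)
    (hs : 1 ≤ s) (hP : ‖P‖ ≤ s ^ 2) (hε : 0 ≤ ε) (hA : ‖A' - A‖ ≤ ε) (hB : ‖B' - B‖ ≤ ε)
    (hη : 4 * s ^ 4 * ε * (1 + ε) ≤ η) (hη1 : η < 1) : Stabilizable A' B' := by
  refine ⟨riccatiGain A B P, stable_of_lyapunov (sub_pos.2 hη1) h.nonneg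
    (le_trans (add_le_add_right ?_ _) (h.perturbed_lyapunov hRx hs hP hε hA hB hη))⟩
  exact smul_mono_right (sub_pos.2 hη1).le (one_le_gram_add hRx _)

lemma IsDARESolution.perturbed_le (h : IsDARESolution Rx 1 A B P) (hRx : 1 ≤ Rx)
    (hs : 1 ≤ s) (hP : ‖P‖ ≤ s ^ 2) (hε : 0 ≤ ε) (hA : ‖A' - A‖ ≤ ε) (hB : ‖B' - B‖ ≤ ε)
    (hη : 4 * s ^ 4 * ε * (1 + ε) ≤ η) (hη1 : η < 1) {P' : Matrix (Fin n) (Fin n) ℝ}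
    (h' : IsDARESolution Rx 1 A' B' P') : (1 - η) • P' ≤ P := by
  have h1 := h.perturbed_lyapunov hRx hs hP hε hA hB hη
  have h2 := h'.le_cost (riccatiGain A B P)
  have hη0 := (sub_pos.2 hη1).le
  rw [← sub_nonneg]
  -- Comparison for T = P - (1 - η)P' along A' + B'K: P' is at most the cost of K, so the stage
  -- costs cancel.
  refine nonneg_of_conj_le (sub_pos.2 hη1) h.nonneg (le_trans (add_le_add_right
    (smul_mono_right hη0 (one_le_gram_add hRx _)) _) h1) ?_ ?_
  · simp [Matrix.IsSymm, (isSymm_of_nonneg h.nonneg).eq, (isSymm_of_nonneg h'.nonneg).eq]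
  · have h3 := smul_mono_right hη0 h2
    rw [← sub_nonneg] at h1 h3 ⊢
    refine (add_nonneg h1 h3).trans (le_of_eq ?_)
    rw [Matrix.mul_sub, Matrix.sub_mul, Matrix.mul_smul, Matrix.smul_mul]
    module

/-- All terms carry the left factor Bᵀ except one that is already small through B - B'. Pairing with
Δ therefore produces BΔ and never ‖B‖. -/
lemma one_add_conj_mul_gain_sub {P' : Matrix (Fin n) (Fin n) ℝ} (hP : 0 ≤ P) (hP' : 0 ≤ P') :
    (1 + Bᵀ * P * B) * (riccatiGain A' B' P' - riccatiGain A B P) =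
      Bᵀ * (P * ((A - A') + (B - B') * riccatiGain A' B' P') +
        (P - P') * (A' + B' * riccatiGain A' B' P')) +
      (B - B')ᵀ * P' * (A' + B' * riccatiGain A' B' P') := by
  have h1 := one_add_conj_mul_gain hP A B
  have h2 := one_add_conj_mul_gain hP' A' B'
  rw [Matrix.mul_sub, h1]
  -- First-order optimality of K', written through its own closed loop.
  have h3 : riccatiGain A' B' P' = -(B'ᵀ * P' * (A' + B' * riccatiGain A' B' P')) := by
    rw [Matrix.add_mul, Matrix.one_mul] at h2
    rw [Matrix.mul_add, neg_add, ← h2]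
    simp only [Matrix.mul_assoc]
    abel
  rw [Matrix.add_mul, Matrix.one_mul]
  generalize riccatiGain A' B' P' = K at *
  nth_rw 1 [h3]
  simp only [Matrix.mul_add, Matrix.sub_mul, Matrix.mul_sub, Matrix.transpose_sub,
    Matrix.mul_assoc]
  abel

lemma norm_mul_le_of_one_add_conj_mul_eq (hP : 1 ≤ P) {Δ : Matrix (Fin m) (Fin n) ℝ}
    {a : Matrix (Fin n) (Fin n) ℝ} {b : Matrix (Fin m) (Fin n) ℝ}
    (h : (1 + Bᵀ * P * B) * Δ = Bᵀ * a + b) : ‖B * Δ‖ ≤ ‖a‖ + ‖b‖ := by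
  set G := B * Δ with hG
  have hZ : Δᵀ * Δ + Gᵀ * P * G = Gᵀ * a + Δᵀ * b := by
    have := congrArg (Δᵀ * ·) h
    simp only [Matrix.mul_add, Matrix.add_mul, Matrix.one_mul] at this
    simpa [hG, Matrix.transpose_mul, Matrix.mul_assoc] using this
  have hPs := (isSymm_of_nonneg (zero_le_one_matrix.trans hP)).eq
  have hZ' := congrArg Matrix.transpose hZ
  simp only [Matrix.transpose_add, Matrix.transpose_mul, Matrix.transpose_transpose, hPs,
    ← Matrix.mul_assoc] at hZ'
  have h1 : Gᵀ * G ≤ Gᵀ * P * G := by simpa using conj_mono hP G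
  have h2 := add_nonneg (gram_nonneg (G - a)) (gram_nonneg (Δ - b))
  have h3 : Gᵀ * G ≤ aᵀ * a + bᵀ * b := by
    -- The expansion of this nonnegative sum equals aᵀa + bᵀb - GᵀG: the cross terms cancel by `hZ`
    -- and its transpose.
    have h4 := add_nonneg (add_nonneg (add_nonneg h2 (gram_nonneg Δ)) (sub_nonneg.2 h1))
      (sub_nonneg.2 h1)
    rw [← sub_nonneg]
    refine h4.trans (le_of_eq ?_)
    simp only [Matrix.transpose_sub, Matrix.mul_sub, Matrix.sub_mul]
    have e1 : Gᵀ * a = Δᵀ * Δ + Gᵀ * P * G - Δᵀ * b := by rw [hZ]; abel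
    have e2 : aᵀ * G = Δᵀ * Δ + Gᵀ * P * G - bᵀ * Δ := by rw [hZ']; abel
    rw [e1, e2]
    abel
  refine norm_le_of_gram_le (by positivity) (h3.trans ((add_le_add (gram_le_norm a)
    (gram_le_norm b)).trans ?_))
  rw [← add_smul]
  refine smul_one_mono ?_
  nlinarith [norm_nonneg a, norm_nonneg b]

end DARE

/-! ### Explicit constants. -/

section Gain

variable {Rx A A' P P' : Matrix (Fin n) (Fin n) ℝ} {B B' : Matrix (Fin n) (Fin m) ℝ} {s ε : ℝ}

/-- The constant 54 is fixed here: 52 · 55/54² < 1 for the first bound, and 40 · (21/20)⁴ · 55/54² <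
1 for the second. -/
lemma stepsize_bounds (hs : 1 ≤ s) (hε : 0 ≤ ε) (hsε : 54 * s ^ 10 * ε ≤ 1) :
    4 * s ^ 4 * ε * (1 + ε) ≤ (13 * s ^ 6)⁻¹ ∧
      4 * (21 / 20 * s) ^ 4 * ε * (1 + ε) ≤ (10 * s ^ 6)⁻¹ := by
  have hs6 : 0 < s ^ 6 := by positivity
  have h10 : 1 ≤ s ^ 10 := one_le_pow₀ hs
  have hε1 : ε ≤ 1 / 54 := by nlinarith
  have h1 : s ^ 10 * ε * (1 + ε) ≤ 1 / 54 * (55 / 54) := by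
    have : s ^ 10 * ε ≤ 1 / 54 := by linarith
    have h2 : 1 + ε ≤ 55 / 54 := by linarith
    exact mul_le_mul this h2 (by linarith) (by norm_num)
  constructor
  · rw [← one_div, le_div_iff₀ (by positivity)]
    nlinarith
  · rw [← one_div, le_div_iff₀ (by positivity)]
    nlinarith

lemma IsDARESolution.norm_perturbed_le (h : IsDARESolution Rx 1 A B P) (hRx : 1 ≤ Rx)
    (hs : 1 ≤ s) (hP : ‖P‖ ≤ s ^ 2) (hε : 0 ≤ ε) (hsε : 54 * s ^ 10 * ε ≤ 1)
    (hA : ‖A' - A‖ ≤ ε) (hB : ‖B' - B‖ ≤ ε) (h' : IsDARESolution Rx 1 A' B' P') :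
    ‖P'‖ ≤ 13 / 12 * s ^ 2 := by
  have hs6 : 1 ≤ s ^ 6 := one_le_pow₀ hs
  have hη13 : (13 * s ^ 6)⁻¹ ≤ 1 / 13 := by
    rw [inv_eq_one_div]
    exact one_div_le_one_div_of_le (by norm_num) (by linarith)
  have h1 := h.perturbed_le hRx hs hP hε hA hB (stepsize_bounds hs hε hsε).1 (by linarith) h'
  have h2 := (smul_mono (show 12 / 13 ≤ 1 - (13 * s ^ 6)⁻¹ by linarith) h'.nonneg).trans
    (h1.trans (le_smul_one_of_norm_le h.nonneg hP))
  have h3 := smul_mono_right (show (0 : ℝ) ≤ 13 / 12 by norm_num) h2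
  rw [smul_smul, smul_smul] at h3
  norm_num at h3
  exact norm_le_of_le_smul_one (by positivity) h'.nonneg h3

lemma IsDARESolution.norm_sub_le (h : IsDARESolution Rx 1 A B P) (hRx : 1 ≤ Rx)
    (hs : 1 ≤ s) (hP : ‖P‖ ≤ s ^ 2) (hε : 0 ≤ ε) (hsε : 54 * s ^ 10 * ε ≤ 1)
    (hA : ‖A' - A‖ ≤ ε) (hB : ‖B' - B‖ ≤ ε) (h' : IsDARESolution Rx 1 A' B' P') :
    ‖P - P'‖ ≤ (10 * s ^ 4)⁻¹ := by
  have hs0 : 0 < s := by linarith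
  have hs6 : 1 ≤ s ^ 6 := one_le_pow₀ hs
  have hP' := h.norm_perturbed_le hRx hs hP hε hsε hA hB h'
  have hη13 : (13 * s ^ 6)⁻¹ < 1 := inv_lt_one_of_one_lt₀ (by linarith)
  have hη10 : (10 * s ^ 6)⁻¹ < 1 := inv_lt_one_of_one_lt₀ (by linarith)
  obtain ⟨b1, b2⟩ := stepsize_bounds hs hε hsε
  have h1 := h.perturbed_le hRx hs hP hε hA hB b1 hη13 h'
  -- The roles are exchanged. The scale 21/20 * s is admissible because 13/12 ≤ (21/20)².
  have h2 := h'.perturbed_le hRx (s := 21 / 20 * s) (by linarith)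
    (hP'.trans (by nlinarith)) hε (by rwa [norm_sub_rev]) (by rwa [norm_sub_rev]) b2 hη10 h
  refine norm_le_of_sandwich (by positivity) ?_ ?_
  · have h3 := smul_mono_right (show 0 ≤ (13 * s ^ 6)⁻¹ by positivity)
      (le_smul_one_of_norm_le h'.nonneg hP')
    have h4 : (13 * s ^ 6)⁻¹ * (13 / 12 * s ^ 2) ≤ (10 * s ^ 4)⁻¹ := by
      field_simp
      norm_num
    rw [smul_smul] at h3
    have h5 := h3.trans (smul_one_mono h4)
    rw [← sub_nonneg] at h1 h5 ⊢
    refine (add_nonneg h1 h5).trans (le_of_eq ?_)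
    module
  · have h3 := smul_mono_right (show 0 ≤ (10 * s ^ 6)⁻¹ by positivity)
      (le_smul_one_of_norm_le h.nonneg hP)
    have h4 : (10 * s ^ 6)⁻¹ * s ^ 2 = (10 * s ^ 4)⁻¹ := by
      field_simp
    rw [smul_smul, h4] at h3
    rw [← sub_nonneg] at h2 h3 ⊢
    refine (add_nonneg h2 h3).trans (le_of_eq ?_)
    module

lemma IsDARESolution.norm_mul_gain_sub_le (h : IsDARESolution Rx 1 A B P) (hRx : 1 ≤ Rx)
    (hs : 1 ≤ s) (hP : ‖P‖ ≤ s ^ 2) (hε : 0 ≤ ε) (hsε : 54 * s ^ 10 * ε ≤ 1)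
    (hA : ‖A' - A‖ ≤ ε) (hB : ‖B' - B‖ ≤ ε) (h' : IsDARESolution Rx 1 A' B' P') :
    ‖B * (riccatiGain A' B' P' - riccatiGain A B P)‖ ≤ (5 * s ^ 3)⁻¹ := by
  have hs0 : 0 < s := by linarith
  have hP' := h.norm_perturbed_le hRx hs hP hε hsε hA hB h'
  have hP'' : ‖P'‖ ≤ (21 / 20 * s) ^ 2 := hP'.trans (by nlinarith)
  have hPP := h.norm_sub_le hRx hs hP hε hsε hA hB h'
  have hK' := h'.norm_gain_le hRx (by positivity) hP''
  have hY := norm_le_of_lyapunov (h'.one_le hRx) (h'.lyapunov hRx) (by positivity) hP''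
  refine (norm_mul_le_of_one_add_conj_mul_eq (h.one_le hRx)
    (one_add_conj_mul_gain_sub h.nonneg h'.nonneg)).trans ?_
  set Y := A' + B' * riccatiGain A' B' P'
  have hE := norm_closedLoop_sub_le (A := A') (A' := A) (B := B') (B' := B)
    (by linarith : 1 ≤ 21 / 20 * s) hε hK' (by rwa [norm_sub_rev]) (by rwa [norm_sub_rev])
  set E := (A - A') + (B - B') * riccatiGain A' B' P'
  have ha : ‖P * E + (P - P') * Y‖ ≤
      s ^ 2 * (2 * (21 / 20 * s) * ε) + (10 * s ^ 4)⁻¹ * (21 / 20 * s) := by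
    refine (norm_add_le _ _).trans (add_le_add ((Matrix.l2_opNorm_mul _ _).trans ?_)
      ((Matrix.l2_opNorm_mul _ _).trans ?_))
    · gcongr
    · gcongr
  have hb : ‖(B - B')ᵀ * P' * Y‖ ≤ ε * (13 / 12 * s ^ 2) * (21 / 20 * s) := by
    refine (Matrix.l2_opNorm_mul _ _).trans ?_
    have h1 := Matrix.l2_opNorm_mul (B - B')ᵀ P'
    rw [norm_transpose, norm_sub_rev] at h1
    have h2 : ‖(B - B')ᵀ * P'‖ ≤ ε * (13 / 12 * s ^ 2) := h1.trans (by gcongr)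
    gcongr
  refine (add_le_add ha hb).trans ?_
  have h3 : ε * s ^ 3 ≤ 1 / 54 * (s ^ 3)⁻¹ := by
    rw [← div_eq_mul_inv, le_div_iff₀ (by positivity)]
    have h4 : s ^ 6 ≤ s ^ 10 := pow_le_pow_right₀ hs (by norm_num)
    nlinarith
  have h5 : (10 * s ^ 4)⁻¹ * (21 / 20 * s) = 21 / 200 * (s ^ 3)⁻¹ := by
    field_simp
    norm_num
  rw [h5, mul_inv]
  have : 0 < (s ^ 3)⁻¹ := by positivity
  nlinarith

end Gain

/-! ### Resolvent bounds on the unit circle. -/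

section Hinf

variable {X X' : Matrix (Fin n) (Fin n) ℝ} {z : ℂ}

lemma Stable.isUnit_resolvent (h : Stable X) (hz : ‖z‖ = 1) :
    IsUnit (z • (1 : Matrix (Fin n) (Fin n) ℂ) - toComplex X) := by
  have : spectralRadius ℂ (toComplex X) < (‖z‖₊ : ENNReal) := by
    have e : ‖z‖₊ = 1 := NNReal.eq hz
    rw [e]
    exact_mod_cast h
  have h2 := spectrum.mem_resolventSet_of_spectralRadius_lt this
  rwa [spectrum.mem_resolventSet_iff, Algebra.algebraMap_eq_smul_one] at h2

/-- In the norm ‖Mu‖ with D = MᵀM, zu = Xu + w gives ‖Mu‖ - ‖MXu‖ ≤ ‖Mw‖. The Lyapunov inequality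
gives ‖u‖² ≤ ‖Mu‖² - ‖MXu‖², and factoring this difference yields ‖u‖² ≤ 2‖M‖²‖w‖‖u‖. -/
lemma norm_resolvent_le {D : Matrix (Fin n) (Fin n) ℝ} (hD : 0 ≤ D) (h : Xᵀ * D * X + 1 ≤ D)
    (hz : ‖z‖ = 1) : ‖(z • (1 : Matrix (Fin n) (Fin n) ℂ) - toComplex X)⁻¹‖ ≤ 2 * ‖D‖ := by
  have hu := (stable_of_lyapunov one_pos hD (by simpa using h)).isUnit_resolvent hz
  obtain ⟨M, rfl⟩ := exists_gram hD
  have hμ : ‖Mᵀ * M‖ = ‖M‖ ^ 2 := by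
    have := M.l2_opNorm_conjTranspose_mul_self
    rwa [Matrix.conjTranspose_eq_transpose_of_trivial, ← pow_two] at this
  rw [hμ, Matrix.l2_opNorm_def]
  refine ContinuousLinearMap.opNorm_le_bound _ (by positivity) fun w => ?_
  set R := z • (1 : Matrix (Fin n) (Fin n) ℂ) - toComplex X with hR
  have hRw : R *ᵥ (R⁻¹ *ᵥ w.ofLp) = w.ofLp := by
    rw [Matrix.mulVec_mulVec, Matrix.mul_nonsing_inv _ ((Matrix.isUnit_iff_isUnit_det _).1 hu),
      Matrix.one_mulVec]
  change ‖WithLp.toLp 2 (R⁻¹ *ᵥ w.ofLp)‖ ≤ _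
  set u := R⁻¹ *ᵥ w.ofLp
  have hzu : z • u = toComplex X *ᵥ u + w.ofLp := by
    rw [hR, Matrix.sub_mulVec, Matrix.smul_mulVec, Matrix.one_mulVec] at hRw
    rw [← hRw]; abel
  have hop : ∀ v : Fin n → ℂ, ‖WithLp.toLp 2 (toComplex M *ᵥ v)‖ ≤ ‖M‖ * ‖WithLp.toLp 2 v‖ :=
    fun v => ((toComplex M).l2_opNorm_mulVec (WithLp.toLp 2 v)).trans
      (mul_le_mul_of_nonneg_right (norm_toComplex_le M) (norm_nonneg _))
  have h1 := complex_lyapunov (c := 1) (by simpa using h) u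
  have h2 := hop u
  have h3 := hop w.ofLp
  have h4 : ‖WithLp.toLp 2 (toComplex M *ᵥ u)‖ ≤
      ‖WithLp.toLp 2 (toComplex M *ᵥ (toComplex X *ᵥ u))‖ +
        ‖WithLp.toLp 2 (toComplex M *ᵥ w.ofLp)‖ := by
    have h5 := congrArg (fun v => ‖WithLp.toLp 2 (toComplex M *ᵥ v)‖) hzu
    simp only [Matrix.mulVec_smul, WithLp.toLp_smul, norm_smul, hz, one_mul, Matrix.mulVec_add,
      WithLp.toLp_add] at h5
    rw [h5]
    exact norm_add_le _ _
  rw [WithLp.toLp_ofLp] at h3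
  have p1 := norm_nonneg (WithLp.toLp 2 u)
  have p2 := norm_nonneg (WithLp.toLp 2 (toComplex M *ᵥ u))
  have p3 := norm_nonneg (WithLp.toLp 2 (toComplex M *ᵥ (toComplex X *ᵥ u)))
  have p4 := norm_nonneg M
  have p5 := norm_nonneg w
  generalize ‖WithLp.toLp 2 u‖ = t at *
  generalize ‖WithLp.toLp 2 (toComplex M *ᵥ u)‖ = α at *
  generalize ‖WithLp.toLp 2 (toComplex M *ᵥ (toComplex X *ᵥ u))‖ = β at *
  generalize ‖WithLp.toLp 2 (toComplex M *ᵥ w.ofLp)‖ = γ at *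
  generalize ‖M‖ = μ at *
  generalize ‖w‖ = ω at *
  have hβα : β ≤ α := le_of_sq_le_sq (by nlinarith) p2
  have h6 : t * t ≤ 2 * μ ^ 2 * ω * t := by
    have e1 : (α - β) * (α + β) ≤ (μ * ω) * (2 * α) :=
      mul_le_mul (by linarith) (by linarith) (by linarith) (by positivity)
    have e2 : (μ * ω) * (2 * α) ≤ (μ * ω) * (2 * (μ * t)) := by gcongr
    nlinarith
  rcases p1.eq_or_lt with h0 | h0
  · rw [← h0]; positivity
  · exact le_of_mul_le_mul_right h6 h0

lemma bddAbove_resolvent {c : ℝ}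
    (h : ∀ z : ℂ, ‖z‖ = 1 → ‖(z • (1 : Matrix (Fin n) (Fin n) ℂ) - toComplex X)⁻¹‖ ≤ c) :
    BddAbove (Set.range fun z : Metric.sphere (0 : ℂ) 1 =>
      ‖((z : ℂ) • (1 : Matrix (Fin n) (Fin n) ℂ) - toComplex X)⁻¹‖) := by
  refine ⟨c, ?_⟩
  rintro _ ⟨z, rfl⟩
  exact h z (by simp)

lemma HinfNorm_le {c : ℝ}
    (h : ∀ z : ℂ, ‖z‖ = 1 → ‖(z • (1 : Matrix (Fin n) (Fin n) ℂ) - toComplex X)⁻¹‖ ≤ c) :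
    HinfNorm X ≤ c := by
  have : Nonempty (Metric.sphere (0 : ℂ) 1) := ⟨1, by simp⟩
  exact ciSup_le fun z => h z (by simp)

lemma HinfNorm_add_le_two_mul {E : Matrix (Fin n) (Fin n) ℝ} {c : ℝ} (hX : Stable X)
    (hXE : Stable (X + E))
    (h : ∀ z : ℂ, ‖z‖ = 1 → ‖(z • (1 : Matrix (Fin n) (Fin n) ℂ) - toComplex X)⁻¹‖ ≤ c)
    (hE : c * ‖E‖ ≤ 1 / 2) : HinfNorm (X + E) ≤ 2 * HinfNorm X := by
  refine HinfNorm_le fun z hz => ?_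
  have hsup : ‖(z • (1 : Matrix (Fin n) (Fin n) ℂ) - toComplex X)⁻¹‖ ≤ HinfNorm X :=
    le_ciSup (bddAbove_resolvent h) ⟨z, by simpa using hz⟩
  have e : toComplex (X + E) = toComplex X + toComplex E := by
    ext i j; simp [toComplex]
  have u1 := (Matrix.isUnit_iff_isUnit_det _).1 (hX.isUnit_resolvent hz)
  have u2 := (Matrix.isUnit_iff_isUnit_det _).1 (hXE.isUnit_resolvent hz)
  have hc := h z hz
  set R := z • (1 : Matrix (Fin n) (Fin n) ℂ) - toComplex X
  set R' := z • (1 : Matrix (Fin n) (Fin n) ℂ) - toComplex (X + E)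
  -- Resolvent identity; since c‖E‖ ≤ 1/2, half of ‖R'⁻¹‖ is absorbed on the left.
  have hR : R'⁻¹ = R⁻¹ + R⁻¹ * toComplex E * R'⁻¹ := by
    have e2 : toComplex E = R - R' := by simp only [R, R', e]; abel
    rw [e2, mul_sub, sub_mul, Matrix.nonsing_inv_mul _ u1, one_mul, mul_assoc,
      Matrix.mul_nonsing_inv _ u2, mul_one]
    abel
  have h1 : ‖R'⁻¹‖ ≤ ‖R⁻¹‖ + 1 / 2 * ‖R'⁻¹‖ := by
    conv_lhs => rw [hR]
    refine (norm_add_le _ _).trans (add_le_add_right ((norm_mul_le _ _).trans ?_) _)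
    refine mul_le_mul_of_nonneg_right ((norm_mul_le _ _).trans (le_trans ?_ hE))
      (norm_nonneg _)
    exact mul_le_mul hc (norm_toComplex_le E) (norm_nonneg _) ((norm_nonneg _).trans hc)
  linarith

end Hinf

/-! ### Dimension zero and the main theorem. -/

lemma HinfNorm_of_isEmpty (X : Matrix (Fin 0) (Fin 0) ℝ) : HinfNorm X = 0 := by
  refine le_antisymm (HinfNorm_le fun z _ => ?_) (Real.iSup_nonneg fun _ => norm_nonneg _)
  rw [Subsingleton.elim (z • (1 : Matrix (Fin 0) (Fin 0) ℂ) - toComplex X)⁻¹ 0, norm_zero]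

lemma stable_of_isEmpty (X : Matrix (Fin 0) (Fin 0) ℝ) : Stable X := by
  simp [Stable, spectrum.SpectralRadius.of_subsingleton]

end LQR

end

theorem mainTheorem7 (n m : ℕ)
    (Rx : Matrix (Fin n) (Fin n) ℝ) (Ru : Matrix (Fin m) (Fin m) ℝ)
    (hRx : 1 ≤ Rx) (hRu : Ru = 1)
    (A Ahat : Matrix (Fin n) (Fin n) ℝ) (B Bhat : Matrix (Fin n) (Fin m) ℝ)
    (hstab : LQR.Stabilizable A B)
    (hclose : max ‖Ahat - A‖ ‖Bhat - B‖ ≤ 1 / LQR.Csafe Rx Ru A B)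
    (P D Acl AclHat : Matrix (Fin n) (Fin n) ℝ)
    (hP : P = LQR.Pinf Rx Ru A B)
    (hAcl : Acl = A + B * LQR.Kinf Rx Ru A B)
    (hAclHat : AclHat = A + B * LQR.Kinf Rx Ru Ahat Bhat)
    (hD : D = LQR.dlyap Acl 1) :
    -- all the objects in the claim are well defined
    (LQR.Stabilizable Ahat Bhat ∧ LQR.Stable Acl ∧ LQR.Stable AclHat) ∧
    -- the Lyapunov matrix lies between the identity and the value matrix
    (1 ≤ D ∧ D ≤ P) ∧
    -- the closed loops have bounded norm
    (LQR.HinfNorm AclHat ≤ 2 * LQR.HinfNorm Acl ∧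
      2 * LQR.HinfNorm Acl ≤ 4 * ‖D‖ ^ (3 / 2 : ℝ) ∧
      4 * ‖D‖ ^ (3 / 2 : ℝ) ≤ 4 * ‖P‖ ^ (3 / 2 : ℝ)) ∧
    -- the Lyapunov matrix is common to all the perturbed closed loops
    (AclHatᵀ * D * AclHat ≤ (1 - 1 / 2 * ‖D‖⁻¹) • D ∧
      (1 - 1 / 2 * ‖D‖⁻¹) • D ≤ (1 - 1 / 2 * ‖P‖⁻¹) • D) := by
  open LQR in
  subst hRu
  -- Dimension zero is separate because there ‖1‖ = 0, so ‖P‖ ≥ 1 fails.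
  rcases n.eq_zero_or_pos with rfl | hn
  · have hs : ∀ S T : Matrix (Fin 0) (Fin 0) ℝ, S ≤ T := fun S T =>
      (Subsingleton.elim S T).le
    refine ⟨⟨⟨0, stable_of_isEmpty _⟩, stable_of_isEmpty _, stable_of_isEmpty _⟩,
      ⟨hs _ _, hs _ _⟩, ⟨?_, ?_, ?_⟩, hs _ _, hs _ _⟩
    · simp [HinfNorm_of_isEmpty]
    · rw [HinfNorm_of_isEmpty, mul_zero]
      positivity
    · rw [Subsingleton.elim D P]
  have : NeZero n := ⟨hn.ne'⟩
  have hRx0 := zero_le_one_matrix.trans hRx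
  have hsol := isDARESolution_Pinf hRx0 hstab
  rw [← hP] at hsol
  have hK : Kinf Rx 1 A B = riccatiGain A B P := by rw [hP]; rfl
  rw [hK] at hAcl
  have hnorm1 : ‖(1 : Matrix (Fin n) (Fin n) ℝ)‖ = 1 := CStarRing.norm_one
  have hP1 : 1 ≤ ‖P‖ := hnorm1 ▸ norm_le_norm_of_le zero_le_one_matrix (hsol.one_le hRx)
  set s := √‖P‖ with hs_def
  have hs : 1 ≤ s := Real.one_le_sqrt.2 hP1
  have hs2 : ‖P‖ = s ^ 2 := (Real.sq_sqrt (norm_nonneg _)).symm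
  obtain ⟨hA, hB⟩ := max_le_iff.1 hclose
  rw [Csafe, ← hP] at hA hB
  set ε := 1 / (54 * ‖P‖ ^ 5) with hε_def
  have hε : 0 ≤ ε := by positivity
  have hsε : 54 * s ^ 10 * ε ≤ 1 := by
    rw [hε_def, hs2]
    refine le_of_eq ?_
    field_simp
  have hstab' : Stabilizable Ahat Bhat :=
    hsol.perturbed_stabilizable hRx hs hs2.le hε hA hB (stepsize_bounds hs hε hsε).1
      (inv_lt_one_of_one_lt₀ (by linarith [one_le_pow₀ hs (n := 6)]))
  have hsol' := isDARESolution_Pinf hRx0 hstab'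
  have hδ := hsol.norm_mul_gain_sub_le hRx hs hs2.le hε hsε hA hB hsol'
  set E := B * (riccatiGain Ahat Bhat (Pinf Rx 1 Ahat Bhat) - riccatiGain A B P)
  have hE : AclHat = Acl + E := by
    have hK' : Kinf Rx 1 Ahat Bhat = riccatiGain Ahat Bhat (Pinf Rx 1 Ahat Bhat) := rfl
    rw [hAclHat, hAcl, hK']
    simp only [E, Matrix.mul_sub]
    abel
  have hLyapP := hsol.lyapunov hRx
  have hXst := hsol.stable hRx
  rw [← hAcl] at hLyapP hXst
  obtain ⟨hD0, hDeq⟩ := exists_dlyap hXst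
  rw [← hD] at hD0 hDeq
  have hD1 : 1 ≤ D := by
    rw [hDeq]
    exact le_add_of_nonneg_left (conj_nonneg hD0 _)
  have hDP : D ≤ P := by
    rw [← sub_nonneg]
    -- Comparison for T = P - D: the same closed loop decreases P by at least 1 and D by exactly 1.
    refine nonneg_of_conj_le one_pos hsol.nonneg (by simpa using hLyapP) ?_ ?_
    · simp [Matrix.IsSymm, (isSymm_of_nonneg hsol.nonneg).eq, (isSymm_of_nonneg hD0).eq]
    · rw [← sub_nonneg] at hLyapP ⊢
      refine hLyapP.trans (le_of_eq ?_)
      nth_rw 1 [hDeq]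
      rw [Matrix.mul_sub, Matrix.sub_mul]
      abel
  have hDn1 : 1 ≤ ‖D‖ := hnorm1 ▸ norm_le_norm_of_le zero_le_one_matrix hD1
  have hDPn : ‖D‖ ≤ ‖P‖ := norm_le_norm_of_le hD0 hDP
  have hXn : ‖Acl‖ ≤ s :=
    norm_le_of_lyapunov (hsol.one_le hRx) hLyapP (by positivity) hs2.le
  -- The perturbation costs at most 2/5 + 1/25 of the unit decrease of D, so half of it survives.
  have hHat : AclHatᵀ * D * AclHat + (1 / 2 : ℝ) • 1 ≤ D := by
    have h1 := conj_add_le (isSymm_of_nonneg hD0) Acl E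
    rw [← hE] at h1
    have h2 : 2 * ‖D‖ * ‖Acl‖ * ‖E‖ + ‖D‖ * ‖E‖ ^ 2 ≤ 1 / 2 := by
      have hD2 : ‖D‖ ≤ s ^ 2 := hDPn.trans hs2.le
      calc _ ≤ 2 * s ^ 2 * s * (5 * s ^ 3)⁻¹ + s ^ 2 * (5 * s ^ 3)⁻¹ ^ 2 := by gcongr
        _ = 2 / 5 + 1 / 25 * (s ^ 4)⁻¹ := by field_simp; ring
        _ ≤ 1 / 2 := by linarith [inv_le_one_of_one_le₀ (one_le_pow₀ hs (n := 4))]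
    have h3 := add_le_add_left (h1.trans (add_le_add_right (smul_one_mono h2) _))
      ((1 / 2 : ℝ) • (1 : Matrix (Fin n) (Fin n) ℝ))
    refine h3.trans (le_of_eq ?_)
    nth_rw 2 [hDeq]
    module
  have hHatst : Stable AclHat := stable_of_lyapunov (by norm_num) hD0 hHat
  have hres : ∀ z : ℂ, ‖z‖ = 1 →
      ‖(z • (1 : Matrix (Fin n) (Fin n) ℂ) - toComplex Acl)⁻¹‖ ≤ 2 * ‖D‖ := fun z hz =>
    norm_resolvent_le hD0 hDeq.symm.le hz
  refine ⟨⟨hstab', hXst, hHatst⟩, ⟨hD1, hDP⟩, ⟨?_, ?_, ?_⟩, ?_, ?_⟩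
  · rw [hE] at hHatst ⊢
    refine HinfNorm_add_le_two_mul hXst hHatst hres ?_
    calc 2 * ‖D‖ * ‖E‖ ≤ 2 * s ^ 2 * (5 * s ^ 3)⁻¹ := by
          have hD2 : ‖D‖ ≤ s ^ 2 := hDPn.trans hs2.le
          gcongr
      _ = 2 / 5 * s⁻¹ := by field_simp
      _ ≤ 1 / 2 := by linarith [inv_le_one_of_one_le₀ hs]
  -- The resolvent bound is linear in ‖D‖; the power 3/2 is a weakening that uses ‖D‖ ≥ 1.
  · have h1 := Real.rpow_le_rpow_of_exponent_le hDn1 (show (1 : ℝ) ≤ 3 / 2 by norm_num)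
    rw [Real.rpow_one] at h1
    linarith [HinfNorm_le hres]
  · have := Real.rpow_le_rpow (norm_nonneg D) hDPn (show (0 : ℝ) ≤ 3 / 2 by norm_num)
    linarith
  -- D ≤ ‖D‖ · 1 turns the additive decrease of 1/2 into the contraction factor.
  · have h1 := smul_mono_right (show 0 ≤ 1 / 2 * ‖D‖⁻¹ by positivity)
      (isSymm_le_norm_smul (isSymm_of_nonneg hD0))
    rw [smul_smul, mul_assoc, inv_mul_cancel₀ (by positivity), mul_one] at h1
    rw [← sub_nonneg] at h1 hHat ⊢
    refine (add_nonneg h1 hHat).trans (le_of_eq ?_)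
    module
  · refine smul_mono ?_ hD0
    have := inv_anti₀ (by positivity) hDPn
    linarith
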